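/- For a sequence $u_n \to L$ of real numbers, say that $u_n$ converges quadratically to $L$ if there is a constant $C$ with $|u_{n+1}-L| \le C\,|u_n-L|^2$ for all sufficiently large $n$ and, moreover, $\dfrac{\log|u_{n+1}-L|}{\log|u_n-L|} \to 2$ (asymptotically the number of correct digits is doubled in each iteration; in particular $u_n\ne L$ for all large $n$). For any real parameter $w$, set $$d_0=\frac{1}{\sqrt2},\qquad c_0(w)=2,\qquad a_0(w)=0,$$ and for $n\ge 0$ iterate $$d_{n+1}=\frac{1-\sqrt{1-d_n^2}}{1+\sqrt{1-d_n^2}},\qquad c_{n+1}(w)=2\,c_n(w)\,(1+d_{n+1})^{w-1},$$ $$a_{n+1}(w)=a_n(w)\,(1+d_{n+1})^{w+1}+\tfrac12\,c_{n+1}(w)\,d_{n+1}\,(1-d_{n+1}).$$ Then for every real $w$, the sequence $a_n(w)$ converges quadratically to $$\frac{1}{\Gamma\left(\frac34\right)^{2w-2}\,\pi^{\frac32-\frac w2}}.$$ In particular, each of the following convergences is quadratic: $$a_n(1)\to\frac1\pi,\qquad a_n(3)\to\frac{1}{\Gamma\left(\frac34\right)^4},\qquad a_n\left(\tfrac13\right)\to\left(\frac{\sqrt2}{\Gamma\left(\frac14\right)}\right)^{4/3},$$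 and for $w\in\{1,3,\frac13\}$ all the numbers $d_n$, $c_n(w)$, $a_n(w)$ are algebraic over $\mathbb{Q}$; so these are algebraic algorithms for $\pi$, $\Gamma(3/4)$ and $\Gamma(1/4)$. Finally, the case $w=1$ is the Borweins' quadratic algorithm for $\pi$: if $r_0=\frac12$ and $r_{n+1}=(1+d_{n+1})^2\,r_n-2^{n+1}d_{n+1}$, then $a_n(1)=r_n-2^n d_n^2$ for all $n\ge0$, and $r_n$ converges quadratically to $\frac1\pi$. -/

import Mathlib

open Filter Topology Asymptotics

noncomputable section

namespace QuadAlg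

/-- `u` converges quadratically to `L`: it tends to `L`, the errors satisfy
`|u (n+1) - L| ≤ C |u n - L| ^ 2` for some constant `C` and all large `n`, and the order of
convergence is exactly two, that is, the number of correct digits `-log |u n - L|` is
asymptotically doubled in each iteration. -/
def ConvergesQuadratically (u : ℕ → ℝ) (L : ℝ) : Prop :=
  Tendsto u atTop (𝓝 L) ∧
  (fun n => u (n + 1) - L) =O[atTop] (fun n => (u n - L) ^ 2) ∧
  Tendsto (fun n => Real.log |u (n + 1) - L| / Real.log |u n - L|) atTop (𝓝 2)

/-- `d₀ = 1/√2`, `dₙ₊₁ = (1 - √(1 - dₙ²)) / (1 + √(1 - dₙ²))`. -/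
def d : ℕ → ℝ
  | 0 => 1 / Real.sqrt 2
  | n + 1 => (1 - Real.sqrt (1 - d n ^ 2)) / (1 + Real.sqrt (1 - d n ^ 2))

/-- `c₀ = 2`, `cₙ₊₁ = 2 cₙ (1 + dₙ₊₁)^(w-1)`. -/
def c (w : ℝ) : ℕ → ℝ
  | 0 => 2
  | n + 1 => 2 * c w n * (1 + d (n + 1)) ^ (w - 1)

/-- `a₀ = 0`, `aₙ₊₁ = aₙ (1 + dₙ₊₁)^(w+1) + ½ cₙ₊₁ dₙ₊₁ (1 - dₙ₊₁)`. -/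
def a (w : ℝ) : ℕ → ℝ
  | 0 => 0
  | n + 1 => a w n * (1 + d (n + 1)) ^ (w + 1)
      + 1 / 2 * c w (n + 1) * d (n + 1) * (1 - d (n + 1))

/-- The Borweins' quadratic iteration for `1/π`, over the same sequence `d`:
`r₀ = 1/2`, `rₙ₊₁ = (1 + dₙ₊₁)² rₙ - 2^(n+1) dₙ₊₁`. -/
def borweinR : ℕ → ℝ
  | 0 => 1 / 2
  | n + 1 => (1 + d (n + 1)) ^ 2 * borweinR n - 2 ^ (n + 1) * d (n + 1)

end QuadAlg

end

/-! The `d n` are the ratios `C n / A n` of the arithmetic-geometric mean iteration `A, B` from `√2,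
1`, with `C² = A² - B²`. Let `M` be its limit and `P n = √2 / A n` the product of the factors `1 + d
j`. Then `a w n = P n ^ (w + 1) * Z n / 2`, where `Z n = 1 - ∑_{j<n} 2 ^ (j - 1) C j ^ 2 - 2 ^ n C n
^ 2` is free of `w` (`a_eq`).

Gauss's invariance (`ellipticK_agm`) gives `M = π / K` for `K = ellipticK √2 1`, and beta integrals
give `M` in terms of `Γ(3/4)`. Iterating the Landen step (`ellipticQ_agm`) gives `ellipticQ √2 1 = K
* ∑ 2 ^ (j - 1) C j ^ 2`, while Euler's product of the lemniscatic integrals gives `ellipticQ √2 1 =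
K - M`. Hence `Z n` tends to `M / K = M² / π`, and the limit of `a w` follows.

For the rate, `C n ^ 2 = 4 A (n+1) C (n+1)` makes `C` decay quadratically. The error of `Z n` is
asymptotic to `-2 ^ n C n ^ 2 / 2`, whereas that of `P n` is only `O(C n ^ 2)`. So the error of `a w
n` is asymptotic to a nonzero multiple of `2 ^ n C n ^ 2`, which is enough for quadratic convergence
(`convergesQuadratically_of_tendsto`). -/

noncomputable section

namespace QuadAlg

open MeasureTheory Set

/-! ### Elliptic integrals: integrability and bounds -/

/-- The complete elliptic integral of the first kind in Gauss's symmetric form,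
`∫ 1 / √((u² + a²)(u² + b²))` over the real line. -/
def ellipticK (a b : ℝ) : ℝ :=
  ∫ u : ℝ, 1 / (√(u ^ 2 + a ^ 2) * √(u ^ 2 + b ^ 2))

/-- The regularized elliptic integral of the second kind `∫ (√((u² + a²)/(u² + b²)) - 1)` over
the real line. -/
def ellipticQ (a b : ℝ) : ℝ :=
  ∫ u : ℝ, (√(u ^ 2 + a ^ 2) / √(u ^ 2 + b ^ 2) - 1)

lemma sqrt_sq_add_sq_pos {a : ℝ} (ha : 0 < a) (u : ℝ) : 0 < √(u ^ 2 + a ^ 2) :=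
  Real.sqrt_pos.2 (by positivity)

lemma integrable_one_div_sq_add_sq {a : ℝ} (ha : 0 < a) :
    Integrable fun u : ℝ => 1 / (u ^ 2 + a ^ 2) := by
  have h := (integrable_inv_one_add_sq.comp_div ha.ne').const_mul (1 / a ^ 2)
  refine h.congr (Eventually.of_forall fun u => ?_)
  have := ha.ne'
  have h1 : (0 : ℝ) < a ^ 2 + u ^ 2 := by positivity
  have h2 : (0 : ℝ) < u ^ 2 + a ^ 2 := by positivity
  simp only
  field_simp
  ring

lemma integral_one_div_sq_add_sq {a : ℝ} (ha : 0 < a) :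
    ∫ u : ℝ, 1 / (u ^ 2 + a ^ 2) = Real.pi / a := by
  have h := Measure.integral_comp_div (fun x : ℝ => (1 + x ^ 2)⁻¹) a
  rw [integral_univ_inv_one_add_sq, abs_of_pos ha, smul_eq_mul] at h
  have hc : (fun u : ℝ => 1 / (u ^ 2 + a ^ 2)) = fun u => 1 / a ^ 2 * (1 + (u / a) ^ 2)⁻¹ := by
    funext u
    have := ha.ne'
    have h1 : (0 : ℝ) < a ^ 2 + u ^ 2 := by positivity
    have h2 : (0 : ℝ) < u ^ 2 + a ^ 2 := by positivity
    field_simp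
    ring
  rw [hc, integral_const_mul, h]
  field_simp

lemma integrable_ellipticK {a b : ℝ} (ha : 0 < a) (hb : 0 < b) :
    Integrable fun u : ℝ => 1 / (√(u ^ 2 + a ^ 2) * √(u ^ 2 + b ^ 2)) := by
  refine ((integrable_one_div_sq_add_sq ha).add (integrable_one_div_sq_add_sq hb)).mono'
    (Continuous.aestronglyMeasurable ?_) (Eventually.of_forall fun u => ?_)
  · refine Continuous.div₀ continuous_const (by fun_prop) fun u => ?_
    exact (mul_pos (sqrt_sq_add_sq_pos ha u) (sqrt_sq_add_sq_pos hb u)).ne'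
  · have h1 := sqrt_sq_add_sq_pos ha u
    have h2 := sqrt_sq_add_sq_pos hb u
    have e1 : √(u ^ 2 + a ^ 2) ^ 2 = u ^ 2 + a ^ 2 := Real.sq_sqrt (by positivity)
    have e2 : √(u ^ 2 + b ^ 2) ^ 2 = u ^ 2 + b ^ 2 := Real.sq_sqrt (by positivity)
    rw [Real.norm_of_nonneg (by positivity)]
    simp only [Pi.add_apply]
    have e3 : 1 / (u ^ 2 + a ^ 2) = (1 / √(u ^ 2 + a ^ 2)) ^ 2 := by rw [div_pow, e1, one_pow]
    have e4 : 1 / (u ^ 2 + b ^ 2) = (1 / √(u ^ 2 + b ^ 2)) ^ 2 := by rw [div_pow, e2, one_pow]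
    rw [e3, e4, ← one_div_mul_one_div]
    nlinarith [sq_nonneg (1 / √(u ^ 2 + a ^ 2) - 1 / √(u ^ 2 + b ^ 2)),
      sq_nonneg (1 / √(u ^ 2 + a ^ 2)), sq_nonneg (1 / √(u ^ 2 + b ^ 2))]

lemma ellipticQ_integrand_eq {a b : ℝ} (ha : 0 < a) (hb : 0 < b) (u : ℝ) :
    √(u ^ 2 + a ^ 2) / √(u ^ 2 + b ^ 2) - 1 =
      (a ^ 2 - b ^ 2) / (√(u ^ 2 + b ^ 2) * (√(u ^ 2 + a ^ 2) + √(u ^ 2 + b ^ 2))) := by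
  have h1 := sqrt_sq_add_sq_pos ha u
  have h2 := sqrt_sq_add_sq_pos hb u
  have e1 : √(u ^ 2 + a ^ 2) ^ 2 = u ^ 2 + a ^ 2 := Real.sq_sqrt (by positivity)
  have e2 : √(u ^ 2 + b ^ 2) ^ 2 = u ^ 2 + b ^ 2 := Real.sq_sqrt (by positivity)
  rw [show a ^ 2 - b ^ 2 = √(u ^ 2 + a ^ 2) ^ 2 - √(u ^ 2 + b ^ 2) ^ 2 by rw [e1, e2]; ring]
  field_simp
  ring

lemma ellipticQ_integrand_nonneg {a b : ℝ} (hb : 0 < b) (hab : b ≤ a) (u : ℝ) :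
    0 ≤ √(u ^ 2 + a ^ 2) / √(u ^ 2 + b ^ 2) - 1 := by
  rw [ellipticQ_integrand_eq (hb.trans_le hab) hb]
  have : 0 ≤ a ^ 2 - b ^ 2 := by nlinarith
  positivity

lemma ellipticQ_integrand_le {a b : ℝ} (hb : 0 < b) (hab : b ≤ a) (u : ℝ) :
    √(u ^ 2 + a ^ 2) / √(u ^ 2 + b ^ 2) - 1 ≤
      (a ^ 2 - b ^ 2) * (1 / (√(u ^ 2 + a ^ 2) * √(u ^ 2 + b ^ 2))) := by
  have ha := hb.trans_le hab
  have h1 := sqrt_sq_add_sq_pos ha u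
  have h2 := sqrt_sq_add_sq_pos hb u
  rw [ellipticQ_integrand_eq ha hb, mul_one_div]
  have : 0 ≤ a ^ 2 - b ^ 2 := by nlinarith
  refine div_le_div_of_nonneg_left this (by positivity) ?_
  nlinarith

lemma integrable_ellipticQ {a b : ℝ} (hb : 0 < b) (hab : b ≤ a) :
    Integrable fun u : ℝ => √(u ^ 2 + a ^ 2) / √(u ^ 2 + b ^ 2) - 1 := by
  refine ((integrable_ellipticK (hb.trans_le hab) hb).const_mul (a ^ 2 - b ^ 2)).mono'
    (Continuous.aestronglyMeasurable ?_) (Eventually.of_forall fun u => ?_)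
  · refine (Continuous.div₀ (by fun_prop) (by fun_prop) fun u => ?_).sub continuous_const
    exact (sqrt_sq_add_sq_pos hb u).ne'
  · rw [Real.norm_of_nonneg (ellipticQ_integrand_nonneg hb hab u)]
    exact ellipticQ_integrand_le hb hab u

lemma ellipticQ_nonneg {a b : ℝ} (hb : 0 < b) (hab : b ≤ a) : 0 ≤ ellipticQ a b :=
  integral_nonneg (ellipticQ_integrand_nonneg hb hab)

/-- Along the iteration this makes the second-kind integral as small as `C n ^ 2`, so the remainder
of the Landen sum is negligible. -/
lemma ellipticQ_le {a b : ℝ} (hb : 0 < b) (hab : b ≤ a) :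
    ellipticQ a b ≤ (a ^ 2 - b ^ 2) * ellipticK a b := by
  rw [ellipticQ, ellipticK, ← integral_const_mul]
  exact integral_mono (integrable_ellipticQ hb hab)
    ((integrable_ellipticK (hb.trans_le hab) hb).const_mul _) (ellipticQ_integrand_le hb hab)

lemma ellipticK_le {a b : ℝ} (hb : 0 < b) (hab : b ≤ a) : ellipticK a b ≤ Real.pi / b := by
  rw [ellipticK, ← integral_one_div_sq_add_sq hb]
  refine integral_mono (integrable_ellipticK (hb.trans_le hab) hb)
    (integrable_one_div_sq_add_sq hb) fun u => ?_
  have h2 := sqrt_sq_add_sq_pos hb u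
  have e2 : √(u ^ 2 + b ^ 2) * √(u ^ 2 + b ^ 2) = u ^ 2 + b ^ 2 :=
    Real.mul_self_sqrt (by positivity)
  exact one_div_le_one_div_of_le (by positivity)
    (e2.ge.trans (mul_le_mul_of_nonneg_right (Real.sqrt_le_sqrt (by gcongr)) h2.le))

lemma le_ellipticK {a b : ℝ} (hb : 0 < b) (hab : b ≤ a) : Real.pi / a ≤ ellipticK a b := by
  have ha := hb.trans_le hab
  rw [ellipticK, ← integral_one_div_sq_add_sq ha]
  refine integral_mono (integrable_one_div_sq_add_sq ha)
    (integrable_ellipticK ha hb) fun u => ?_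
  have h1 := sqrt_sq_add_sq_pos ha u
  have h2 := sqrt_sq_add_sq_pos hb u
  have e1 : √(u ^ 2 + a ^ 2) * √(u ^ 2 + a ^ 2) = u ^ 2 + a ^ 2 :=
    Real.mul_self_sqrt (by positivity)
  exact one_div_le_one_div_of_le (by positivity)
    ((mul_le_mul_of_nonneg_left (Real.sqrt_le_sqrt (by gcongr)) h1.le).trans e1.le)

/-! ### The substitution `u = (t - p / t) / 2` and the Gauss and Landen steps -/

section ChangeOfVariables

variable {p : ℝ}

lemma hasDerivAt_half_sub_div {t : ℝ} (ht : 0 < t) :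
    HasDerivAt (fun t : ℝ => (t - p / t) / 2) ((1 + p / t ^ 2) / 2) t := by
  have h := ((hasDerivAt_id t).sub ((hasDerivAt_const t p).div (hasDerivAt_id t) ht.ne')).div_const 2
  refine h.congr_deriv ?_
  simp
  ring

lemma injOn_half_sub_div (hp : 0 < p) : InjOn (fun t : ℝ => (t - p / t) / 2) (Ioi 0) := by
  intro s hs t ht h
  have hs' : (0 : ℝ) < s := hs
  have ht' : (0 : ℝ) < t := ht
  simp only at h
  field_simp at h
  have h2 : (s - t) * (s * t + p) = 0 := by linear_combination h
  rcases mul_eq_zero.1 h2 with h3 | h3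
  · linarith
  · nlinarith [mul_pos hs' ht']

/-- The preimage of `u` is the positive root of `t² - 2 u t - p = 0`. -/
lemma image_half_sub_div (hp : 0 < p) : (fun t : ℝ => (t - p / t) / 2) '' Ioi 0 = univ := by
  refine eq_univ_of_forall fun u => ?_
  have hs : √(u ^ 2 + p) ^ 2 = u ^ 2 + p := Real.sq_sqrt (by positivity)
  have hlt : |u| < √(u ^ 2 + p) := by
    rw [← Real.sqrt_sq_eq_abs]
    exact Real.sqrt_lt_sqrt (sq_nonneg u) (by linarith)
  have hpos : 0 < u + √(u ^ 2 + p) := by linarith [neg_abs_le u]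
  refine ⟨u + √(u ^ 2 + p), hpos, ?_⟩
  simp only
  field_simp
  linear_combination hs

lemma integral_eq_integral_Ioi_half_sub_div (hp : 0 < p) (f : ℝ → ℝ) :
    ∫ u, f u = ∫ t in Ioi (0 : ℝ), (1 + p / t ^ 2) / 2 * f ((t - p / t) / 2) := by
  have h := integral_image_eq_integral_abs_deriv_smul measurableSet_Ioi
    (fun t ht => (hasDerivAt_half_sub_div (p := p) ht).hasDerivWithinAt) (injOn_half_sub_div hp) f
  rw [image_half_sub_div hp, setIntegral_univ] at h
  rw [h]
  refine setIntegral_congr_fun measurableSet_Ioi fun t ht => ?_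
  have : (0 : ℝ) < t := ht
  simp only [smul_eq_mul]
  rw [abs_of_pos (by positivity)]

lemma integrableOn_Ioi_half_sub_div (hp : 0 < p) {f : ℝ → ℝ} (hf : Integrable f) :
    IntegrableOn (fun t => (1 + p / t ^ 2) / 2 * f ((t - p / t) / 2)) (Ioi 0) := by
  have h := integrableOn_image_iff_integrableOn_abs_deriv_smul measurableSet_Ioi
    (fun t ht => (hasDerivAt_half_sub_div (p := p) ht).hasDerivWithinAt) (injOn_half_sub_div hp) f
  rw [image_half_sub_div hp, integrableOn_univ] at h
  refine (h.1 hf).congr_fun (fun t ht => ?_) measurableSet_Ioi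
  have : (0 : ℝ) < t := ht
  simp only [smul_eq_mul]
  rw [abs_of_pos (by positivity)]

end ChangeOfVariables

lemma integral_eq_two_mul_integral_Ioi {f : ℝ → ℝ} (hf : ∀ x, f |x| = f x) :
    ∫ x, f x = 2 * ∫ x in Ioi (0 : ℝ), f x := by
  rw [← integral_comp_abs]
  simp_rw [hf]

/-- With `p = a * b` the radicand becomes `(t² + a²)(t² + b²) / (4 t²)`, so the integrand of the
next stage carries the radicals of the present one. In the companion lemma below the radicand
becomes a perfect square. -/
lemma sqrt_half_sub_div_sq_add_mean_sq {a b t : ℝ} (ht : 0 < t) :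
    √(((t - a * b / t) / 2) ^ 2 + ((a + b) / 2) ^ 2) =
      √(t ^ 2 + a ^ 2) * √(t ^ 2 + b ^ 2) / (2 * t) := by
  rw [← Real.sqrt_mul (by positivity), ← Real.sqrt_sq (show 0 ≤ 2 * t by positivity),
    ← Real.sqrt_div (by positivity)]
  congr 1
  field_simp
  ring

lemma sqrt_half_sub_div_sq_add_mul {a b b' t : ℝ} (ha : 0 < a) (hb : 0 < b)
    (h : b' ^ 2 = a * b) (ht : 0 < t) :
    √(((t - a * b / t) / 2) ^ 2 + b' ^ 2) = (t ^ 2 + a * b) / (2 * t) := by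
  rw [h, ← Real.sqrt_sq (show 0 ≤ (t ^ 2 + a * b) / (2 * t) by positivity)]
  congr 1
  field_simp
  ring

/-- Gauss's invariance of the elliptic integral under the arithmetic-geometric mean step. -/
theorem ellipticK_agm {a b b' : ℝ} (ha : 0 < a) (hb : 0 < b) (h : b' ^ 2 = a * b) :
    ellipticK ((a + b) / 2) b' = ellipticK a b := by
  have hp := mul_pos ha hb
  rw [ellipticK, ellipticK, integral_eq_integral_Ioi_half_sub_div hp,
    integral_eq_two_mul_integral_Ioi (fun x => by rw [sq_abs]), ← integral_const_mul]
  refine setIntegral_congr_fun measurableSet_Ioi fun t ht => ?_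
  have ht : (0 : ℝ) < t := ht
  have h1 := sqrt_sq_add_sq_pos ha t
  have h2 := sqrt_sq_add_sq_pos hb t
  rw [sqrt_half_sub_div_sq_add_mean_sq ht, sqrt_half_sub_div_sq_add_mul ha hb h ht]
  field_simp

lemma hasDerivAt_sqrt_sq_add_sq {a : ℝ} (ha : 0 < a) (t : ℝ) :
    HasDerivAt (fun t : ℝ => √(t ^ 2 + a ^ 2)) (t / √(t ^ 2 + a ^ 2)) t := by
  have h := ((hasDerivAt_pow 2 t).add_const (a ^ 2)).sqrt (by positivity)
  refine h.congr_deriv ?_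
  have := sqrt_sq_add_sq_pos ha t
  simp
  field_simp

lemma abs_le_sqrt_sq_add_sq (a t : ℝ) : |t| ≤ √(t ^ 2 + a ^ 2) :=
  Real.abs_le_sqrt (by nlinarith [sq_nonneg a])

/-- The Landen step for the elliptic integral of the second kind. -/
theorem ellipticQ_agm {a b b' : ℝ} (hb : 0 < b) (hab : b ≤ a) (hb' : 0 < b')
    (h : b' ^ 2 = a * b) :
    ellipticQ a b = 2 * ellipticQ ((a + b) / 2) b' + (a ^ 2 - b ^ 2) / 2 * ellipticK a b := by
  have ha := hb.trans_le hab
  have hp := mul_pos ha hb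
  have hab' : b' ≤ (a + b) / 2 := by
    apply le_of_sq_le_sq _ (by positivity)
    nlinarith [sq_nonneg (a - b)]
  set R : ℝ → ℝ := fun t => √(t ^ 2 + a ^ 2) * √(t ^ 2 + b ^ 2) with hR
  have hRpos : ∀ t, 0 < R t := fun t => mul_pos (sqrt_sq_add_sq_pos ha t) (sqrt_sq_add_sq_pos hb t)
  have hRsq : ∀ t, R t ^ 2 = (t ^ 2 + a ^ 2) * (t ^ 2 + b ^ 2) := fun t => by
    simp only [hR]
    rw [mul_pow, Real.sq_sqrt (by positivity), Real.sq_sqrt (by positivity)]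
  -- the transformed integral at the next stage
  have hcongr : ∀ t ∈ Ioi (0 : ℝ), (1 + a * b / t ^ 2) / 2 *
      (√(((t - a * b / t) / 2) ^ 2 + ((a + b) / 2) ^ 2) /
        √(((t - a * b / t) / 2) ^ 2 + b' ^ 2) - 1) = 1 / 2 * ((R t - t ^ 2 - a * b) / t ^ 2) := by
    intro t ht
    have ht : (0 : ℝ) < t := ht
    rw [sqrt_half_sub_div_sq_add_mean_sq ht, sqrt_half_sub_div_sq_add_mul ha hb h ht]
    simp only [hR]
    field_simp
    ring
  have hQ' : ellipticQ ((a + b) / 2) b' =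
      1 / 2 * ∫ t in Ioi (0 : ℝ), (R t - t ^ 2 - a * b) / t ^ 2 := by
    rw [ellipticQ, integral_eq_integral_Ioi_half_sub_div hp, ← integral_const_mul]
    exact setIntegral_congr_fun measurableSet_Ioi hcongr
  have hint1 : IntegrableOn (fun t => (R t - t ^ 2 - a * b) / t ^ 2) (Ioi 0) := by
    have h1 := (integrableOn_Ioi_half_sub_div hp (integrable_ellipticQ hb' hab')).congr_fun
      hcongr measurableSet_Ioi
    exact (h1.const_mul 2).congr (Eventually.of_forall fun t => by simp only; ring)
  -- the integral at the present stage
  have hpt : ∀ t, 2 * (√(t ^ 2 + a ^ 2) / √(t ^ 2 + b ^ 2) - 1) -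
      (a ^ 2 - b ^ 2) * (1 / (√(t ^ 2 + a ^ 2) * √(t ^ 2 + b ^ 2))) =
      (2 * t ^ 2 + a ^ 2 + b ^ 2) / R t - 2 := by
    intro t
    have h1 := sqrt_sq_add_sq_pos ha t
    have h2 := sqrt_sq_add_sq_pos hb t
    have e1 : √(t ^ 2 + a ^ 2) ^ 2 = t ^ 2 + a ^ 2 := Real.sq_sqrt (by positivity)
    simp only [hR]
    field_simp
    linear_combination 2 * e1
  have hint2' : Integrable fun t => (2 * t ^ 2 + a ^ 2 + b ^ 2) / R t - 2 :=
    (((integrable_ellipticQ hb hab).const_mul 2).sub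
      ((integrable_ellipticK ha hb).const_mul (a ^ 2 - b ^ 2))).congr (Eventually.of_forall hpt)
  have hQ : 2 * ellipticQ a b - (a ^ 2 - b ^ 2) * ellipticK a b =
      2 * ∫ t in Ioi (0 : ℝ), ((2 * t ^ 2 + a ^ 2 + b ^ 2) / R t - 2) := by
    rw [← integral_eq_two_mul_integral_Ioi (fun x => by simp only [hR, sq_abs]), ellipticQ,
      ellipticK, ← integral_const_mul, ← integral_const_mul, ← integral_sub
      ((integrable_ellipticQ hb hab).const_mul 2) ((integrable_ellipticK ha hb).const_mul _)]
    exact integral_congr_ae (Eventually.of_forall hpt)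
  -- integration by parts
  set g : ℝ → ℝ := fun t => (a - b) ^ 2 * t / (R t + t ^ 2 + a * b) with hg
  have hden : ∀ t, 0 < R t + t ^ 2 + a * b := fun t => by
    have := hRpos t
    positivity
  have hderiv : ∀ t ∈ Ioi (0 : ℝ), HasDerivAt g
      (((2 * t ^ 2 + a ^ 2 + b ^ 2) / R t - 2) - (R t - t ^ 2 - a * b) / t ^ 2) t := by
    intro t ht
    have ht : (0 : ℝ) < t := ht
    have hR' : HasDerivAt R (t * (2 * t ^ 2 + a ^ 2 + b ^ 2) / R t) t := by
      refine ((hasDerivAt_sqrt_sq_add_sq ha t).mul (hasDerivAt_sqrt_sq_add_sq hb t)).congr_deriv ?_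
      have h1 := sqrt_sq_add_sq_pos ha t
      have h2 := sqrt_sq_add_sq_pos hb t
      have e1 : √(t ^ 2 + a ^ 2) ^ 2 = t ^ 2 + a ^ 2 := Real.sq_sqrt (by positivity)
      have e2 : √(t ^ 2 + b ^ 2) ^ 2 = t ^ 2 + b ^ 2 := Real.sq_sqrt (by positivity)
      simp only [hR]
      field_simp
      rw [e1, e2]
      ring
    have h1 := ((hR'.sub (hasDerivAt_pow 2 t)).sub_const (a * b)).div (hasDerivAt_id t) ht.ne'
    -- Since `R² - (t² + a b)² = (a - b)² t²`, `g` is the rationalised form of this quotient; it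
    -- extends continuously by `0` to `t = 0`, so both boundary terms vanish.
    have h2 : g =ᶠ[𝓝 t] fun t => (R t - t ^ 2 - a * b) / t := by
      filter_upwards [Ioi_mem_nhds ht] with s hs
      have hs : (0 : ℝ) < s := hs
      have := hden s
      simp only [hg]
      rw [div_eq_div_iff this.ne' hs.ne']
      linear_combination -hRsq s
    refine (h1.congr_of_eventuallyEq h2).congr_deriv ?_
    have := (hRpos t).ne'
    simp
    field_simp
  have hcont : Continuous g := by
    refine Continuous.div₀ (by fun_prop) (by fun_prop) fun t => (hden t).ne'
  have hlim : Tendsto g atTop (𝓝 0) := by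
    have h0 : Tendsto (fun t : ℝ => (a - b) ^ 2 / t) atTop (𝓝 0) :=
      tendsto_const_nhds.div_atTop tendsto_id
    refine squeeze_zero' ?_ ?_ h0
    · filter_upwards [eventually_gt_atTop 0] with t ht
      have := hden t
      simp only [hg]
      positivity
    · filter_upwards [eventually_gt_atTop 0] with t ht
      simp only [hg]
      rw [div_le_div_iff₀ (hden t) ht]
      have := hRpos t
      nlinarith [mul_nonneg (sq_nonneg (a - b)) (add_pos this hp).le]
  have hfin := integral_Ioi_of_hasDerivAt_of_tendsto hcont.continuousWithinAt hderiv
    (hint2'.integrableOn.sub hint1) hlim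
  rw [integral_sub hint2'.integrableOn hint1] at hfin
  simp only [hg, mul_zero, zero_div, sub_zero] at hfin
  linear_combination (1 / 2) * hQ + hfin - 2 * hQ'

/-- Gauss and Landen forms of the integral of the second kind. -/
theorem ellipticQ_eq_integral {a b : ℝ} (hb : 0 < b) (hab : b ≤ a) :
    ellipticQ a b = (a ^ 2 - b ^ 2) * (ellipticK a b -
      b ^ 2 * ∫ t : ℝ, 1 / ((t ^ 2 + b ^ 2) * (√(t ^ 2 + a ^ 2) * √(t ^ 2 + b ^ 2)))) := by
  have ha := hb.trans_le hab
  have hc : 0 ≤ a ^ 2 - b ^ 2 := by nlinarith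
  set I : ℝ → ℝ := fun t => 1 / (√(t ^ 2 + a ^ 2) * √(t ^ 2 + b ^ 2)) with hI
  set J : ℝ → ℝ := fun t => 1 / ((t ^ 2 + b ^ 2) * (√(t ^ 2 + a ^ 2) * √(t ^ 2 + b ^ 2))) with hJ
  have hIint : Integrable I := integrable_ellipticK ha hb
  have hJint : Integrable J := by
    refine (hIint.const_mul (1 / b ^ 2)).mono' (Continuous.aestronglyMeasurable ?_)
      (Eventually.of_forall fun u => ?_)
    · refine Continuous.div₀ continuous_const (by fun_prop) fun u => ?_
      have h1 := sqrt_sq_add_sq_pos ha u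
      have h2 := sqrt_sq_add_sq_pos hb u
      positivity
    · have h1 := sqrt_sq_add_sq_pos ha u
      have h2 := sqrt_sq_add_sq_pos hb u
      rw [Real.norm_of_nonneg (by positivity)]
      simp only [hI, hJ]
      rw [one_div_mul_one_div]
      gcongr
      nlinarith [sq_nonneg u]
  -- Integration by parts against `t`, with `t² = (t² + b²) - b²` in the result. The boundary
  -- function is `O(1 / |t|)`, so its derivative has integral zero.
  have hderiv : ∀ t : ℝ, HasDerivAt (fun t => t * (√(t ^ 2 + a ^ 2) / √(t ^ 2 + b ^ 2) - 1))
      ((√(t ^ 2 + a ^ 2) / √(t ^ 2 + b ^ 2) - 1) - (a ^ 2 - b ^ 2) * (I t - b ^ 2 * J t)) t := by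
    intro t
    have h1 := sqrt_sq_add_sq_pos ha t
    have h2 := sqrt_sq_add_sq_pos hb t
    have e1 : √(t ^ 2 + a ^ 2) ^ 2 = t ^ 2 + a ^ 2 := Real.sq_sqrt (by positivity)
    have e2 : √(t ^ 2 + b ^ 2) ^ 2 = t ^ 2 + b ^ 2 := Real.sq_sqrt (by positivity)
    refine ((hasDerivAt_id t).mul (((hasDerivAt_sqrt_sq_add_sq ha t).div
      (hasDerivAt_sqrt_sq_add_sq hb t) h2.ne').sub_const 1)).congr_deriv ?_
    simp only [hI, hJ, id, Pi.div_apply]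
    have hJ' : 1 / ((t ^ 2 + b ^ 2) * (√(t ^ 2 + a ^ 2) * √(t ^ 2 + b ^ 2))) =
        1 / (√(t ^ 2 + b ^ 2) ^ 2 * (√(t ^ 2 + a ^ 2) * √(t ^ 2 + b ^ 2))) := by rw [e2]
    rw [hJ']
    generalize √(t ^ 2 + a ^ 2) = x at *
    generalize √(t ^ 2 + b ^ 2) = y at *
    field_simp
    rw [e1, e2]
    ring
  have hbound : ∀ t : ℝ, |t * (√(t ^ 2 + a ^ 2) / √(t ^ 2 + b ^ 2) - 1)| ≤
      (a ^ 2 - b ^ 2) * |t|⁻¹ := by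
    intro t
    rcases eq_or_ne t 0 with rfl | ht
    · simp
    have ht' : 0 < |t| := abs_pos.2 ht
    rw [abs_mul, abs_of_nonneg (ellipticQ_integrand_nonneg hb hab t)]
    calc |t| * (√(t ^ 2 + a ^ 2) / √(t ^ 2 + b ^ 2) - 1)
        ≤ |t| * ((a ^ 2 - b ^ 2) * (1 / (|t| * |t|))) := by
          gcongr
          refine (ellipticQ_integrand_le hb hab t).trans ?_
          gcongr
          · exact abs_le_sqrt_sq_add_sq a t
          · exact abs_le_sqrt_sq_add_sq b t
      _ = (a ^ 2 - b ^ 2) * |t|⁻¹ := by field_simp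
  have hlim : ∀ l : Filter ℝ, Tendsto (fun t : ℝ => |t|) l atTop →
      Tendsto (fun t => t * (√(t ^ 2 + a ^ 2) / √(t ^ 2 + b ^ 2) - 1)) l (𝓝 0) := by
    intro l hl
    have h0 := (tendsto_inv_atTop_zero.comp hl).const_mul (a ^ 2 - b ^ 2)
    rw [mul_zero] at h0
    exact squeeze_zero_norm hbound h0
  have hint : Integrable fun t => (a ^ 2 - b ^ 2) * (I t - b ^ 2 * J t) :=
    (hIint.sub (hJint.const_mul (b ^ 2))).const_mul (a ^ 2 - b ^ 2)
  have hfin := integral_of_hasDerivAt_of_tendsto hderiv ((integrable_ellipticQ hb hab).sub hint)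
    (hlim _ tendsto_abs_atBot_atTop) (hlim _ tendsto_abs_atTop_atTop)
  rw [integral_sub (integrable_ellipticQ hb hab) hint, integral_const_mul] at hfin
  have hsplit : ∫ t, (I t - b ^ 2 * J t) = ellipticK a b - b ^ 2 * ∫ t, J t := by
    rw [integral_sub hIint (hJint.const_mul _), integral_const_mul, ellipticK]
  have hfin' : ellipticQ a b - (a ^ 2 - b ^ 2) * ∫ t, (I t - b ^ 2 * J t) = 0 - 0 := hfin
  rw [hsplit] at hfin'
  linarith

/-! ### Lemniscatic values through the beta function -/

lemma beta_eq_integral_Ioo {α β : ℝ} (hα : 0 < α) (hβ : 0 < β) :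
    ProbabilityTheory.beta α β = ∫ x in Ioo (0 : ℝ) 1, x ^ (α - 1) * (1 - x) ^ (β - 1) := by
  rw [ProbabilityTheory.beta_eq_betaIntegralReal α β hα hβ, Complex.betaIntegral,
    intervalIntegral.integral_of_le zero_le_one, integral_Ioc_eq_integral_Ioo]
  rw [← Complex.ofReal_re (∫ x in Ioo (0 : ℝ) 1, x ^ (α - 1) * (1 - x) ^ (β - 1)),
    ← integral_complex_ofReal]
  congr 1
  refine setIntegral_congr_fun measurableSet_Ioo fun x hx => ?_
  rw [Complex.ofReal_mul, Complex.ofReal_cpow hx.1.le, Complex.ofReal_cpow (by linarith [hx.2])]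
  push_cast
  rfl

/-- For `x = (1 + t²)⁻²` one has `1 - x = t² (t² + 2) / (1 + t²)²`, which brings in the radical
`√(t² + 2)` of `ellipticK √2 1`. -/
lemma image_inv_sq_one_add_sq :
    (fun t : ℝ => ((1 + t ^ 2) ^ 2)⁻¹) '' Ioi 0 = Ioo 0 1 := by
  ext y
  constructor
  · rintro ⟨t, ht, rfl⟩
    have ht : (0 : ℝ) < t := ht
    refine ⟨by positivity, inv_lt_one_of_one_lt₀ ?_⟩
    nlinarith [pow_pos ht 2]
  · rintro ⟨h0, h1⟩
    have hs : 0 < √y := Real.sqrt_pos.2 h0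
    have hs1 : √y < 1 := by rw [Real.sqrt_lt' one_pos]; simpa using h1
    have h2 : 0 < (√y)⁻¹ - 1 := by linarith [(one_lt_inv₀ hs).2 hs1]
    refine ⟨√((√y)⁻¹ - 1), Real.sqrt_pos.2 h2, ?_⟩
    simp only
    rw [Real.sq_sqrt h2.le, add_sub_cancel, inv_pow, inv_inv, Real.sq_sqrt h0.le]

lemma injOn_inv_sq_one_add_sq : InjOn (fun t : ℝ => ((1 + t ^ 2) ^ 2)⁻¹) (Ioi 0) := by
  intro s hs t ht h
  have hs : (0 : ℝ) < s := hs
  have ht : (0 : ℝ) < t := ht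
  have h1 : (1 + s ^ 2) ^ 2 = (1 + t ^ 2) ^ 2 := inv_injective h
  have h2 : 1 + s ^ 2 = 1 + t ^ 2 := (sq_eq_sq₀ (by positivity) (by positivity)).1 h1
  exact (sq_eq_sq₀ hs.le ht.le).1 (by linarith)

/-- A lemniscatic form of Euler's beta integral. -/
theorem beta_half_eq_integral {α : ℝ} (hα : 0 < α) :
    ProbabilityTheory.beta α (1 / 2) =
      4 * ∫ t in Ioi (0 : ℝ), (1 + t ^ 2) ^ (-(2 * α)) / √(t ^ 2 + 2) := by
  have hderiv : ∀ t ∈ Ioi (0 : ℝ), HasDerivWithinAt (fun t : ℝ => ((1 + t ^ 2) ^ 2)⁻¹)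
      (-(4 * t / (1 + t ^ 2) ^ 3)) (Ioi 0) t := by
    intro t _
    have h := (((hasDerivAt_pow 2 t).const_add 1).pow 2).inv
      (pow_pos (by positivity : 0 < 1 + t ^ 2) 2).ne'
    refine (h.congr_deriv ?_).hasDerivWithinAt
    have : 0 < 1 + t ^ 2 := by positivity
    simp
    field_simp
    ring
  rw [beta_eq_integral_Ioo hα one_half_pos, ← image_inv_sq_one_add_sq,
    integral_image_eq_integral_abs_deriv_smul measurableSet_Ioi hderiv injOn_inv_sq_one_add_sq,
    ← integral_const_mul]
  refine setIntegral_congr_fun measurableSet_Ioi fun t ht => ?_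
  have ht : (0 : ℝ) < t := ht
  have hz : 0 < 1 + t ^ 2 := by positivity
  have hs : 0 < √(t ^ 2 + 2) := Real.sqrt_pos.2 (by positivity)
  have h1 : (((1 + t ^ 2) ^ 2)⁻¹ : ℝ) ^ (α - 1) = (1 + t ^ 2) ^ (-(2 * α)) * (1 + t ^ 2) ^ 2 := by
    rw [← Real.rpow_natCast (1 + t ^ 2) 2, ← Real.rpow_neg hz.le, ← Real.rpow_mul hz.le,
      ← Real.rpow_add hz]
    congr 1
    push_cast
    ring
  have h2 : (1 - ((1 + t ^ 2) ^ 2)⁻¹ : ℝ) ^ ((1 : ℝ) / 2 - 1) =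
      (1 + t ^ 2) / (t * √(t ^ 2 + 2)) := by
    have h3 : (1 - ((1 + t ^ 2) ^ 2)⁻¹ : ℝ) = (t * √(t ^ 2 + 2) / (1 + t ^ 2)) ^ 2 := by
      rw [div_pow, mul_pow, Real.sq_sqrt (by positivity)]
      field_simp
      ring
    rw [h3, ← Real.rpow_natCast, ← Real.rpow_mul (by positivity)]
    norm_num
    rw [Real.rpow_neg_one, inv_div]
  simp only [smul_eq_mul]
  rw [h1, h2, abs_neg, abs_of_pos (by positivity)]
  field_simp

lemma sqrt_sq_add_sqrt_two_sq (t : ℝ) : √(t ^ 2 + √2 ^ 2) = √(t ^ 2 + 2) := by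
  rw [Real.sq_sqrt zero_le_two]

lemma ellipticK_lemniscatic :
    ellipticK √2 1 = ProbabilityTheory.beta (1 / 4) (1 / 2) / 2 := by
  rw [beta_half_eq_integral (by norm_num), ellipticK,
    integral_eq_two_mul_integral_Ioi (fun x => by rw [sq_abs])]
  have : ∫ x in Ioi (0 : ℝ), 1 / (√(x ^ 2 + √2 ^ 2) * √(x ^ 2 + 1 ^ 2)) =
      ∫ t in Ioi (0 : ℝ), (1 + t ^ 2) ^ (-(2 * (1 / 4) : ℝ)) / √(t ^ 2 + 2) := by
    refine setIntegral_congr_fun measurableSet_Ioi fun t _ => ?_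
    have hz : 0 < 1 + t ^ 2 := by positivity
    rw [sqrt_sq_add_sqrt_two_sq, Real.rpow_neg hz.le, Real.sqrt_eq_rpow (t ^ 2 + 1 ^ 2)]
    norm_num
    rw [add_comm (t ^ 2) 1]
    ring
  rw [this]
  ring

lemma lemniscatic_integral_eq_beta :
    ∫ t : ℝ, 1 / ((t ^ 2 + 1 ^ 2) * (√(t ^ 2 + √2 ^ 2) * √(t ^ 2 + 1 ^ 2))) =
      ProbabilityTheory.beta (3 / 4) (1 / 2) / 2 := by
  rw [beta_half_eq_integral (by norm_num),
    integral_eq_two_mul_integral_Ioi (fun x => by rw [sq_abs])]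
  have : ∫ t in Ioi (0 : ℝ), 1 / ((t ^ 2 + 1 ^ 2) * (√(t ^ 2 + √2 ^ 2) * √(t ^ 2 + 1 ^ 2))) =
      ∫ t in Ioi (0 : ℝ), (1 + t ^ 2) ^ (-(2 * (3 / 4) : ℝ)) / √(t ^ 2 + 2) := by
    refine setIntegral_congr_fun measurableSet_Ioi fun t _ => ?_
    have hz : 0 < 1 + t ^ 2 := by positivity
    have hs : 0 < √(t ^ 2 + 2) := Real.sqrt_pos.2 (by positivity)
    have hs' : 0 < √(1 + t ^ 2) := Real.sqrt_pos.2 (by positivity)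
    have h1 : (1 + t ^ 2) ^ (-(2 * (3 / 4) : ℝ)) = ((1 + t ^ 2) * √(1 + t ^ 2))⁻¹ := by
      rw [Real.rpow_neg hz.le, Real.sqrt_eq_rpow]
      nth_rw 2 [← Real.rpow_one (1 + t ^ 2)]
      rw [← Real.rpow_add hz]
      norm_num
    rw [sqrt_sq_add_sqrt_two_sq, h1, one_pow, add_comm (t ^ 2) 1]
    field_simp
  rw [this]
  ring

lemma Gamma_one_fourth_mul_Gamma_three_fourths :
    Real.Gamma (1 / 4) * Real.Gamma (3 / 4) = Real.pi * √2 := by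
  have h := Real.Gamma_mul_Gamma_one_sub (1 / 4)
  rw [show (1 : ℝ) - 1 / 4 = 3 / 4 by norm_num, show Real.pi * (1 / 4) = Real.pi / 4 by ring,
    Real.sin_pi_div_four] at h
  rw [h]
  have h2 : √2 ^ 2 = 2 := Real.sq_sqrt zero_le_two
  have : 0 < √2 := by positivity
  field_simp
  linear_combination -h2

lemma ellipticK_lemniscatic_eq_Gamma :
    ellipticK √2 1 = Real.pi * √Real.pi / (√2 * Real.Gamma (3 / 4) ^ 2) := by
  have hG := Gamma_one_fourth_mul_Gamma_three_fourths
  have h3 : 0 < Real.Gamma (3 / 4) := Real.Gamma_pos_of_pos (by norm_num)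
  have h2 : √2 ^ 2 = 2 := Real.sq_sqrt zero_le_two
  rw [ellipticK_lemniscatic, ProbabilityTheory.beta, Real.Gamma_one_half_eq,
    show (1 / 4 + 1 / 2 : ℝ) = 3 / 4 by norm_num]
  have : 0 < √2 := by positivity
  field_simp
  linear_combination √2 * hG + Real.pi * h2

/-- Euler's product of the two lemniscatic integrals (a case of Legendre's relation). -/
lemma lemniscatic_integral_mul_ellipticK :
    (∫ t : ℝ, 1 / ((t ^ 2 + 1 ^ 2) * (√(t ^ 2 + √2 ^ 2) * √(t ^ 2 + 1 ^ 2)))) *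
      ellipticK √2 1 = Real.pi := by
  have h3 : 0 < Real.Gamma (3 / 4) := Real.Gamma_pos_of_pos (by norm_num)
  have h1 : 0 < Real.Gamma (1 / 4) := Real.Gamma_pos_of_pos (by norm_num)
  have h5 : Real.Gamma (1 / 4 + 1) = 1 / 4 * Real.Gamma (1 / 4) :=
    Real.Gamma_add_one (by norm_num)
  have hp : √Real.pi ^ 2 = Real.pi := Real.sq_sqrt Real.pi_pos.le
  rw [lemniscatic_integral_eq_beta, ellipticK_lemniscatic, ProbabilityTheory.beta,
    ProbabilityTheory.beta, Real.Gamma_one_half_eq, show (1 / 4 + 1 / 2 : ℝ) = 3 / 4 by norm_num,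
    show (3 / 4 + 1 / 2 : ℝ) = 1 / 4 + 1 by norm_num, h5]
  field_simp
  linear_combination 4 * hp

/-! ### The arithmetic-geometric mean iteration -/

lemma d_pos_and_lt_one (n : ℕ) : 0 < d n ∧ d n < 1 := by
  induction n with
  | zero =>
    rw [d]
    exact ⟨by positivity, (div_lt_one (by positivity)).2 Real.one_lt_sqrt_two⟩
  | succ n ih =>
    rw [d]
    have h0 : 0 < √(1 - d n ^ 2) := Real.sqrt_pos.2 (by nlinarith)
    have h1 : √(1 - d n ^ 2) < 1 := by
      rw [Real.sqrt_lt' one_pos]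
      nlinarith
    refine ⟨div_pos (by linarith) (by linarith), (div_lt_one (by linarith)).2 (by linarith)⟩

lemma d_pos (n : ℕ) : 0 < d n := (d_pos_and_lt_one n).1

lemma d_lt_one (n : ℕ) : d n < 1 := (d_pos_and_lt_one n).2

lemma one_add_d_pos (n : ℕ) : 0 < 1 + d n := by linarith [d_pos n]

/-- The arithmetic means of the arithmetic-geometric mean iteration started at `√2, 1`,
written in terms of the moduli `d`. -/
def agmA : ℕ → ℝ
  | 0 => √2
  | n + 1 => agmA n / (1 + d (n + 1))

/-- The geometric means of the arithmetic-geometric mean iteration started at `√2, 1`. -/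
def agmB (n : ℕ) : ℝ := agmA n * √(1 - d n ^ 2)

/-- The third sequence `√(A² - B²)` of the arithmetic-geometric mean iteration. -/
def agmC (n : ℕ) : ℝ := agmA n * d n

lemma agmA_pos (n : ℕ) : 0 < agmA n := by
  induction n with
  | zero => rw [agmA]; positivity
  | succ n ih => rw [agmA]; exact div_pos ih (one_add_d_pos _)

lemma sqrt_one_sub_d_sq_pos (n : ℕ) : 0 < √(1 - d n ^ 2) :=
  Real.sqrt_pos.2 (by nlinarith [d_pos n, d_lt_one n])

lemma sq_sqrt_one_sub_d_sq (n : ℕ) : √(1 - d n ^ 2) ^ 2 = 1 - d n ^ 2 :=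
  Real.sq_sqrt (by nlinarith [d_pos n, d_lt_one n])

lemma agmB_pos (n : ℕ) : 0 < agmB n := mul_pos (agmA_pos n) (sqrt_one_sub_d_sq_pos n)

lemma agmC_pos (n : ℕ) : 0 < agmC n := mul_pos (agmA_pos n) (d_pos n)

lemma agmA_succ (n : ℕ) : agmA (n + 1) = (agmA n + agmB n) / 2 := by
  rw [agmA, agmB, d]
  have := sqrt_one_sub_d_sq_pos n
  field_simp
  ring

lemma agmC_succ (n : ℕ) : agmC (n + 1) = (agmA n - agmB n) / 2 := by
  rw [agmC, agmA_succ, agmB, d]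
  have := sqrt_one_sub_d_sq_pos n
  field_simp

lemma agmC_sq (n : ℕ) : agmC n ^ 2 = agmA n ^ 2 - agmB n ^ 2 := by
  rw [agmC, agmB]
  linear_combination agmA n ^ 2 * sq_sqrt_one_sub_d_sq n

lemma agmB_succ_sq (n : ℕ) : agmB (n + 1) ^ 2 = agmA n * agmB n := by
  have h := agmC_sq (n + 1)
  rw [agmC_succ, agmA_succ] at h
  linear_combination h

/-- The factorisation `A² - B² = (A + B)(A - B)`; this is the source of quadratic convergence. -/
lemma agmC_sq_eq (n : ℕ) : agmC n ^ 2 = 4 * agmA (n + 1) * agmC (n + 1) := by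
  rw [agmC_succ, agmA_succ, agmC_sq]
  ring

lemma agmB_le_agmA (n : ℕ) : agmB n ≤ agmA n := by
  have := agmC_succ n
  linarith [agmC_pos (n + 1)]

lemma agmA_zero : agmA 0 = √2 := rfl

lemma agmC_zero : agmC 0 = 1 := by
  rw [agmC, agmA_zero, d, mul_one_div, div_self (by positivity)]

lemma agmB_zero : agmB 0 = 1 := by
  have h := agmC_sq 0
  rw [agmC_zero, agmA_zero, Real.sq_sqrt zero_le_two] at h
  refine (sq_eq_sq₀ (agmB_pos 0).le zero_le_one).1 ?_
  linarith

lemma agmA_antitone : Antitone agmA := by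
  refine antitone_nat_of_succ_le fun n => ?_
  rw [agmA_succ]
  linarith [agmB_le_agmA n]

lemma ellipticK_agmA_agmB (n : ℕ) : ellipticK (agmA n) (agmB n) = ellipticK √2 1 := by
  induction n with
  | zero => rw [agmA_zero, agmB_zero]
  | succ n ih => rw [← ih, agmA_succ, ellipticK_agm (agmA_pos n) (agmB_pos n) (agmB_succ_sq n)]

/-- The arithmetic-geometric mean of `√2` and `1`, as an elliptic integral. -/
def agmLimit : ℝ := Real.pi / ellipticK √2 1

lemma ellipticK_pos : 0 < ellipticK √2 1 :=
  (div_pos Real.pi_pos (by positivity)).trans_le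
    (le_ellipticK one_pos Real.one_lt_sqrt_two.le)

/-- The invariant integral lies between `π / A n` and `π / B n`, which traps `agmLimit` between the
two means before any convergence is known. -/
lemma agmB_le_agmLimit (n : ℕ) : agmB n ≤ agmLimit := by
  have h := ellipticK_le (agmB_pos n) (agmB_le_agmA n)
  rw [ellipticK_agmA_agmB, le_div_iff₀ (agmB_pos n)] at h
  rw [agmLimit, le_div_iff₀ ellipticK_pos]
  linarith

lemma agmLimit_le_agmA (n : ℕ) : agmLimit ≤ agmA n := by
  have h := le_ellipticK (agmB_pos n) (agmB_le_agmA n)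
  rw [ellipticK_agmA_agmB, div_le_iff₀ (agmA_pos n)] at h
  rw [agmLimit, div_le_iff₀ ellipticK_pos]
  linarith

lemma one_le_agmLimit : 1 ≤ agmLimit := agmB_zero ▸ agmB_le_agmLimit 0

lemma agmLimit_pos : 0 < agmLimit := one_pos.trans_le one_le_agmLimit

lemma agmLimit_eq : agmLimit = √2 * Real.Gamma (3 / 4) ^ 2 / √Real.pi := by
  have h3 : 0 < Real.Gamma (3 / 4) := Real.Gamma_pos_of_pos (by norm_num)
  have := Real.pi_pos
  rw [agmLimit, ellipticK_lemniscatic_eq_Gamma]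
  field_simp

/-- `agmC`, scaled so that the quadratic recursion has leading coefficient tending to `1`. -/
def agmY (n : ℕ) : ℝ := agmC n / (4 * agmLimit)

lemma agmY_pos (n : ℕ) : 0 < agmY n := div_pos (agmC_pos n) (by linarith [agmLimit_pos])

lemma agmY_succ (n : ℕ) : agmY (n + 1) = agmLimit / agmA (n + 1) * agmY n ^ 2 := by
  have := agmLimit_pos
  have := agmA_pos (n + 1)
  rw [agmY, agmY, div_pow, agmC_sq_eq]
  field_simp

lemma agmY_succ_le (n : ℕ) : agmY (n + 1) ≤ agmY n ^ 2 := by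
  rw [agmY_succ]
  exact mul_le_of_le_one_left (sq_nonneg _)
    ((div_le_one (agmA_pos _)).2 (agmLimit_le_agmA _))

/-- The lower bound excludes convergence of order greater than two. -/
lemma le_agmY_succ (n : ℕ) : agmLimit / √2 * agmY n ^ 2 ≤ agmY (n + 1) := by
  rw [agmY_succ]
  have := agmA_pos (n + 1)
  have := agmLimit_pos
  have : agmA (n + 1) ≤ √2 := agmA_antitone (Nat.zero_le _)
  gcongr

lemma agmY_le (n : ℕ) : agmY n ≤ (1 / 4) ^ 2 ^ n := by
  induction n with
  | zero =>
    have := one_le_agmLimit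
    rw [agmY, agmC_zero, pow_zero, pow_one]
    gcongr
    linarith
  | succ n ih =>
    rw [pow_succ 2 n, pow_mul]
    exact (agmY_succ_le n).trans (pow_le_pow_left₀ (agmY_pos n).le ih 2)

/-! ### A criterion for quadratic convergence -/

section QuadraticConvergence

variable {y : ℕ → ℝ}

lemma two_pow_mul_sq_le (hy : ∀ n, 0 < y n) (hle : ∀ n, y n ≤ (1 / 4) ^ 2 ^ n) (n : ℕ) :
    2 ^ n * y n ^ 2 ≤ (1 / 2) ^ n := by
  have h1 : y n ≤ (1 / 4) ^ n := (hle n).trans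
    (pow_le_pow_of_le_one (by norm_num) (by norm_num) Nat.lt_two_pow_self.le)
  have h2 : y n ≤ 1 := h1.trans (pow_le_one₀ (by norm_num) (by norm_num))
  have h3 : y n ^ 2 ≤ (1 / 4) ^ n := by nlinarith [hy n]
  calc (2 : ℝ) ^ n * y n ^ 2 ≤ 2 ^ n * (1 / 4) ^ n := by gcongr
    _ = (1 / 2) ^ n := by rw [← mul_pow]; norm_num

lemma log_le_neg_two_pow (hy : ∀ n, 0 < y n) (hle : ∀ n, y n ≤ (1 / 4) ^ 2 ^ n) (n : ℕ) :
    Real.log (y n) ≤ -(2 ^ n * Real.log 4) := by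
  refine (Real.log_le_log (hy n) (hle n)).trans_eq ?_
  rw [Real.log_pow, one_div, Real.log_inv]
  push_cast
  ring

lemma tendsto_log_inv_zero (hy : ∀ n, 0 < y n) (hle : ∀ n, y n ≤ (1 / 4) ^ 2 ^ n) :
    Tendsto (fun n => (Real.log (y n))⁻¹) atTop (𝓝 0) := by
  have h4 : 0 < Real.log 4 := Real.log_pos (by norm_num)
  refine tendsto_inv_atBot_zero.comp (tendsto_atBot_mono (log_le_neg_two_pow hy hle) ?_)
  exact tendsto_neg_atTop_atBot.comp
    ((tendsto_pow_atTop_atTop_of_one_lt one_lt_two).atTop_mul_const h4)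

/-- The factor `2 ^ n` of the error adds `n log 2` to its logarithm; this is negligible against `log
(y n)`. -/
lemma tendsto_natCast_div_log (hy : ∀ n, 0 < y n) (hle : ∀ n, y n ≤ (1 / 4) ^ 2 ^ n) :
    Tendsto (fun n : ℕ => (n : ℝ) * (Real.log (y n))⁻¹) atTop (𝓝 0) := by
  have h4 : 0 < Real.log 4 := Real.log_pos (by norm_num)
  have h0 := (tendsto_pow_const_div_const_pow_of_one_lt 1 (one_lt_two (α := ℝ))).mul_const
    (Real.log 4)⁻¹
  rw [zero_mul] at h0
  refine squeeze_zero_norm (fun n => ?_) h0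
  have h := log_le_neg_two_pow hy hle n
  have hp : 0 < 2 ^ n * Real.log 4 := by positivity
  rw [norm_mul, norm_inv, Real.norm_of_nonneg (Nat.cast_nonneg n), Real.norm_of_nonpos (by linarith),
    pow_one, div_mul_eq_mul_div, mul_div_assoc, div_eq_mul_inv _ ((2 : ℝ) ^ n), ← mul_inv,
    mul_comm (Real.log 4)]
  gcongr
  linarith

/-- If the error of `u` is asymptotic to a non-zero multiple of `2 ^ n * y n ^ 2`, where `y`
satisfies a quadratic recursion, then `u` converges quadratically. -/
theorem convergesQuadratically_of_tendsto {u : ℕ → ℝ} {L κ m : ℝ} (hy : ∀ n, 0 < y n)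
    (hle : ∀ n, y n ≤ (1 / 4) ^ 2 ^ n) (hsucc : ∀ n, y (n + 1) ≤ y n ^ 2) (hm : 0 < m)
    (hlow : ∀ n, m * y n ^ 2 ≤ y (n + 1)) (hκ : κ ≠ 0)
    (h : Tendsto (fun n => (u n - L) / (2 ^ n * y n ^ 2)) atTop (𝓝 κ)) :
    ConvergesQuadratically u L := by
  set q : ℕ → ℝ := fun n => (u n - L) / (2 ^ n * y n ^ 2) with hq
  have hu : ∀ n, u n - L = q n * (2 ^ n * y n ^ 2) := fun n => by
    have := hy n
    simp only [hq]
    field_simp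
  have hκ' : 0 < |κ| := abs_pos.2 hκ
  have hqabs : Tendsto (fun n => |q n|) atTop (𝓝 |κ|) := h.abs
  have hzero : Tendsto (fun n => 2 ^ n * y n ^ 2) atTop (𝓝 0) := by
    refine squeeze_zero (fun n => by have := hy n; positivity) (two_pow_mul_sq_le hy hle) ?_
    exact tendsto_pow_atTop_nhds_zero_of_lt_one (by norm_num) (by norm_num)
  refine ⟨?_, ?_, ?_⟩
  · rw [← tendsto_sub_nhds_zero_iff]
    have h1 := h.mul hzero
    rw [mul_zero] at h1
    exact h1.congr fun n => (hu n).symm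
  -- Eventually `|q (n + 1)| < 2 |κ|` and `|q n| > |κ| / 2`; with `2 ^ (n + 1) ≤ 2 * (2 ^ n) ^ 2`
  -- the constant is `4 |κ| / (|κ| / 2) ^ 2`.
  · refine IsBigO.of_bound (16 / |κ|) ?_
    have hup : ∀ᶠ n in atTop, |q (n + 1)| < 2 * |κ| :=
      ((tendsto_add_atTop_iff_nat 1).2 hqabs).eventually_lt_const (by linarith)
    have hdn : ∀ᶠ n in atTop, |κ| / 2 < |q n| := hqabs.eventually_const_lt (by linarith)
    filter_upwards [hup, hdn] with n h1 h2
    have hy0 := hy n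
    have hy1 := hy (n + 1)
    have hpow : (1 : ℝ) ≤ 2 ^ n := one_le_pow₀ one_le_two
    rw [hu, hu, Real.norm_eq_abs, Real.norm_eq_abs, abs_pow, abs_mul (q (n + 1)), abs_mul (q n),
      abs_of_pos (show 0 < 2 ^ n * y n ^ 2 by positivity),
      abs_of_pos (show 0 < 2 ^ (n + 1) * y (n + 1) ^ 2 by positivity)]
    calc |q (n + 1)| * (2 ^ (n + 1) * y (n + 1) ^ 2)
        ≤ 2 * |κ| * (2 ^ (n + 1) * (y n ^ 2) ^ 2) := by
          gcongr
          exact hsucc n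
      _ = 4 * |κ| * (1 * 2 ^ n * (y n ^ 2) ^ 2) := by ring
      _ ≤ 4 * |κ| * (2 ^ n * 2 ^ n * (y n ^ 2) ^ 2) := by gcongr
      _ = 16 / |κ| * (|κ| / 2 * (2 ^ n * y n ^ 2)) ^ 2 := by
          field_simp
          ring
      _ ≤ 16 / |κ| * (|q n| * (2 ^ n * y n ^ 2)) ^ 2 := by gcongr
  · have hinv := tendsto_log_inv_zero hy hle
    have hlog : ∀ n, Real.log (y n) < 0 := fun n => by
      have h4 : 0 < Real.log 4 := Real.log_pos (by norm_num)
      have : 0 < 2 ^ n * Real.log 4 := by positivity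
      linarith [log_le_neg_two_pow hy hle n]
    have hr : Tendsto (fun n => Real.log |u n - L| / Real.log (y n)) atTop (𝓝 2) := by
      have h1 := (((hqabs.log hκ'.ne').mul hinv).add
        ((tendsto_natCast_div_log hy hle).mul_const (Real.log 2))).add_const 2
      rw [mul_zero, zero_mul, zero_add, zero_add] at h1
      refine h1.congr' ?_
      filter_upwards [hqabs.eventually_const_lt hκ'] with n hn
      have hy0 := hy n
      have := (hlog n).ne
      rw [hu, abs_mul, abs_of_pos (show 0 < 2 ^ n * y n ^ 2 by positivity),
        Real.log_mul hn.ne' (by positivity), Real.log_mul (by positivity) (by positivity),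
        Real.log_pow, Real.log_pow]
      field_simp
      push_cast
      ring
    have hs : Tendsto (fun n => Real.log (y (n + 1)) / Real.log (y n)) atTop (𝓝 2) := by
      -- The two recursion bounds place the difference of logarithms between `log m` and `0`.
      have hb : Tendsto (fun n => (Real.log (y (n + 1)) - 2 * Real.log (y n)) *
          (Real.log (y n))⁻¹) atTop (𝓝 0) := by
        have h0 := (hinv.norm).const_mul |Real.log m|
        rw [norm_zero, mul_zero] at h0
        refine squeeze_zero_norm (fun n => ?_) h0
        rw [norm_mul]
        gcongr
        have hy0 := hy n
        have h1 := Real.log_le_log (hy (n + 1)) (hsucc n)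
        have h2 := Real.log_le_log (by positivity) (hlow n)
        rw [Real.log_mul (by positivity) (by positivity)] at h2
        rw [Real.log_pow] at h1 h2
        push_cast at h1 h2
        rw [Real.norm_eq_abs, abs_of_nonpos (by linarith)]
        linarith [neg_le_abs (Real.log m)]
      have h1 := hb.add_const 2
      rw [zero_add] at h1
      refine h1.congr fun n => ?_
      have := (hlog n).ne
      field_simp
      ring
    -- The ratio of log errors is compared through `log (y n)`, giving `2 * 2 / 2`.
    have hfin := (((tendsto_add_atTop_iff_nat 1).2 hr).mul hs).div hr two_ne_zero
    rw [mul_div_assoc, div_self two_ne_zero, mul_one] at hfin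
    refine hfin.congr fun n => ?_
    simp only [Pi.div_apply]
    rw [div_mul_div_cancel₀ (hlog (n + 1)).ne, div_div_div_cancel_right₀ (hlog n).ne]

end QuadraticConvergence

/-! ### Closed form and error asymptotics of the algorithm -/

/-- The product `(1 + d 1) ⋯ (1 + d n)`. -/
def agmP (n : ℕ) : ℝ := √2 / agmA n

lemma agmP_pos (n : ℕ) : 0 < agmP n := div_pos (by positivity) (agmA_pos n)

lemma agmP_zero : agmP 0 = 1 := div_self (by positivity)

lemma agmP_succ (n : ℕ) : agmP (n + 1) = agmP n * (1 + d (n + 1)) := by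
  rw [agmP, agmP, agmA, div_div_eq_mul_div, div_mul_eq_mul_div]

lemma c_eq (w : ℝ) (n : ℕ) : c w n = 2 ^ (n + 1) * agmP n ^ (w - 1) := by
  induction n with
  | zero => simp [c, agmP_zero]
  | succ n ih =>
    rw [c, ih, agmP_succ, Real.mul_rpow (agmP_pos n).le (one_add_d_pos _).le]
    ring

/-- The partial sums `1 - ∑ 2 ^ (j - 1) C_j² - 2 ^ n C_n²` that govern the algorithm. -/
def agmZ (n : ℕ) : ℝ :=
  1 - ∑ j ∈ Finset.range n, 2 ^ j / 2 * agmC j ^ 2 - 2 ^ n * agmC n ^ 2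

lemma agmZ_succ (n : ℕ) :
    agmZ (n + 1) = agmZ n + 2 ^ (n + 1) * agmA (n + 1) ^ 2 * (d (n + 1) * (1 - d (n + 1))) := by
  have h := agmC_sq_eq n
  rw [agmZ, agmZ, Finset.sum_range_succ]
  rw [agmC] at h
  simp only [agmC] at h ⊢
  linear_combination 2 ^ n / 2 * h

/-- Since `P ^ (w - 1) = P ^ (w + 1) * A² / 2`, dividing the recursion by `P ^ (w + 1)` removes `w`
and leaves that of `agmZ`. -/
lemma a_eq (w : ℝ) (n : ℕ) : a w n = agmP n ^ (w + 1) * agmZ n / 2 := by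
  induction n with
  | zero => simp [a, agmZ, agmC_zero]
  | succ n ih =>
    have h : agmP (n + 1) ^ (w - 1) = agmP (n + 1) ^ (w + 1) * (agmA (n + 1) ^ 2 / 2) := by
      have hP := agmP_pos (n + 1)
      have hA := agmA_pos (n + 1)
      rw [show w - 1 = w + 1 - (2 : ℕ) by push_cast; ring, Real.rpow_sub_natCast hP.ne', agmP,
        div_pow, Real.sq_sqrt zero_le_two, div_div_eq_mul_div, mul_div_assoc]
    rw [a, c_eq, h, ih, agmZ_succ]
    have h2 : agmP (n + 1) ^ (w + 1) = agmP n ^ (w + 1) * (1 + d (n + 1)) ^ (w + 1) := by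
      rw [agmP_succ, Real.mul_rpow (agmP_pos n).le (one_add_d_pos _).le]
    rw [h2]
    ring

lemma ellipticQ_agm_iterate (n : ℕ) :
    ellipticQ (agmA n) (agmB n) = 2 * ellipticQ (agmA (n + 1)) (agmB (n + 1)) +
      agmC n ^ 2 / 2 * ellipticK √2 1 := by
  rw [ellipticQ_agm (agmB_pos n) (agmB_le_agmA n) (agmB_pos (n + 1)) (agmB_succ_sq n),
    ← agmA_succ, ellipticK_agmA_agmB, agmC_sq]

lemma ellipticQ_eq_sum (n : ℕ) :
    ellipticQ √2 1 = 2 ^ n * ellipticQ (agmA n) (agmB n) +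
      (∑ j ∈ Finset.range n, 2 ^ j / 2 * agmC j ^ 2) * ellipticK √2 1 := by
  induction n with
  | zero => simp [agmA_zero, agmB_zero]
  | succ n ih =>
    rw [ih, Finset.sum_range_succ, ellipticQ_agm_iterate n]
    ring

lemma ellipticQ_lemniscatic : ellipticQ √2 1 = ellipticK √2 1 - agmLimit := by
  rw [ellipticQ_eq_integral one_pos Real.one_lt_sqrt_two.le, agmLimit,
    eq_div_of_mul_eq ellipticK_pos.ne' lemniscatic_integral_mul_ellipticK,
    Real.sq_sqrt zero_le_two]
  ring

/-- The tail of the sum is its first term `2 ^ n C n ^ 2 / 2` plus a Landen remainder; subtracting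
`2 ^ n C n ^ 2` leaves the leading coefficient `-1 / 2`. -/
lemma agmZ_sub_eq (n : ℕ) :
    agmZ n - agmLimit ^ 2 / Real.pi = 2 ^ n * agmC n ^ 2 *
      (-1 / 2 + 2 * (ellipticQ (agmA (n + 1)) (agmB (n + 1)) /
        (agmC n ^ 2 * ellipticK √2 1))) := by
  have h1 := ellipticQ_eq_sum n
  rw [ellipticQ_lemniscatic, ellipticQ_agm_iterate] at h1
  have hK := ellipticK_pos
  have hC := agmC_pos n
  have hp := Real.pi_pos
  have h2 : agmLimit ^ 2 / Real.pi = agmLimit / ellipticK √2 1 := by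
    nth_rw 1 [agmLimit]
    rw [agmLimit]
    field_simp
  rw [h2, agmZ]
  generalize ∑ j ∈ Finset.range n, 2 ^ j / 2 * agmC j ^ 2 = S at *
  field_simp
  linear_combination 2 * h1

lemma tendsto_agmY : Tendsto agmY atTop (𝓝 0) := by
  refine squeeze_zero (fun n => (agmY_pos n).le) agmY_le ?_
  exact (tendsto_pow_atTop_nhds_zero_of_lt_one (by norm_num) (by norm_num)).comp
    (tendsto_pow_atTop_atTop_of_one_lt one_lt_two)

/-- `A n - M ≤ A n - B n = 2 C (n + 1)`, which is already quadratic in `y n`. -/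
lemma agmA_sub_agmLimit_le (n : ℕ) : agmA n - agmLimit ≤ 8 * agmLimit * agmY n ^ 2 := by
  have h1 := agmC_succ n
  have h2 := agmB_le_agmLimit n
  have h3 : agmC (n + 1) = 4 * agmLimit * agmY (n + 1) := by
    have := agmLimit_pos
    rw [agmY]
    field_simp
  have h4 := mul_le_mul_of_nonneg_left (agmY_succ_le n) agmLimit_pos.le
  linarith

lemma tendsto_agmA : Tendsto agmA atTop (𝓝 agmLimit) := by
  rw [← tendsto_sub_nhds_zero_iff]
  have h := (tendsto_agmY.pow 2).const_mul (8 * agmLimit)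
  rw [zero_pow two_ne_zero, mul_zero] at h
  exact squeeze_zero (fun n => sub_nonneg.2 (agmLimit_le_agmA n)) agmA_sub_agmLimit_le h

lemma tendsto_agmZ_sub :
    Tendsto (fun n => (agmZ n - agmLimit ^ 2 / Real.pi) / (2 ^ n * agmY n ^ 2)) atTop
      (𝓝 (-(8 * agmLimit ^ 2))) := by
  have hM := agmLimit_pos
  have hK := ellipticK_pos
  have hQ : Tendsto (fun n => ellipticQ (agmA (n + 1)) (agmB (n + 1)) /
      (agmC n ^ 2 * ellipticK √2 1)) atTop (𝓝 0) := by
    have h0 := tendsto_agmY.pow 2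
    rw [zero_pow two_ne_zero] at h0
    refine squeeze_zero (fun n => ?_) (fun n => ?_) h0
    · have := ellipticQ_nonneg (agmB_pos (n + 1)) (agmB_le_agmA (n + 1))
      have := agmC_pos n
      positivity
    · have hC := agmC_pos n
      have h1 := ellipticQ_le (agmB_pos (n + 1)) (agmB_le_agmA (n + 1))
      rw [ellipticK_agmA_agmB, ← agmC_sq] at h1
      rw [div_le_iff₀ (by positivity)]
      have e1 : agmC (n + 1) = 4 * agmLimit * agmY (n + 1) := by rw [agmY]; field_simp
      have e2 : agmC n = 4 * agmLimit * agmY n := by rw [agmY]; field_simp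
      rw [e1] at h1
      rw [e2]
      have h2 := pow_le_pow_left₀ (agmY_pos (n + 1)).le (agmY_succ_le n) 2
      calc _ ≤ (4 * agmLimit * agmY (n + 1)) ^ 2 * ellipticK √2 1 := h1
        _ = (4 * agmLimit) ^ 2 * agmY (n + 1) ^ 2 * ellipticK √2 1 := by ring
        _ ≤ (4 * agmLimit) ^ 2 * (agmY n ^ 2) ^ 2 * ellipticK √2 1 := by gcongr
        _ = _ := by ring
  have h := ((hQ.const_mul 2).const_add (-1 / 2)).const_mul (16 * agmLimit ^ 2)
  rw [show 16 * agmLimit ^ 2 * (-1 / 2 + 2 * 0) = -(8 * agmLimit ^ 2) by ring] at h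
  refine h.congr fun n => ?_
  have hY := agmY_pos n
  have e2 : agmC n = 4 * agmLimit * agmY n := by rw [agmY]; field_simp
  rw [agmZ_sub_eq, eq_div_iff (by positivity)]
  generalize ellipticQ (agmA (n + 1)) (agmB (n + 1)) / (agmC n ^ 2 * ellipticK √2 1) = r
  rw [e2]
  ring

lemma tendsto_agmP : Tendsto agmP atTop (𝓝 (√2 / agmLimit)) :=
  tendsto_const_nhds.div tendsto_agmA agmLimit_pos.ne'

lemma agmP_sub_isBigO : (fun n => agmP n - √2 / agmLimit) =O[atTop] fun n => agmY n ^ 2 := by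
  refine IsBigO.of_bound (√2 * 8 / agmLimit) (Eventually.of_forall fun n => ?_)
  have hM := agmLimit_pos
  have hA := agmA_pos n
  have hMA := agmLimit_le_agmA n
  have h : agmP n - √2 / agmLimit = -(√2 * (agmA n - agmLimit) / (agmA n * agmLimit)) := by
    rw [agmP]
    field_simp
    ring
  rw [h, norm_neg, Real.norm_of_nonneg (div_nonneg (mul_nonneg (by positivity) (by linarith))
    (by positivity)), Real.norm_of_nonneg (by positivity)]
  calc √2 * (agmA n - agmLimit) / (agmA n * agmLimit)
      ≤ √2 * (8 * agmLimit * agmY n ^ 2) / (agmLimit * agmLimit) := by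
        gcongr
        exact agmA_sub_agmLimit_le n
    _ = √2 * 8 / agmLimit * agmY n ^ 2 := by field_simp

/-- The error of `P n ^ s` is `O(y n ^ 2)` without the factor `2 ^ n`, so it does not affect the
leading term. -/
lemma tendsto_agmP_rpow_sub (s : ℝ) :
    Tendsto (fun n => (agmP n ^ s - (√2 / agmLimit) ^ s) / (2 ^ n * agmY n ^ 2)) atTop
      (𝓝 0) := by
  have hP : √2 / agmLimit ≠ 0 := (div_pos (by positivity) agmLimit_pos).ne'
  have h1 : (fun n => agmP n ^ s - (√2 / agmLimit) ^ s) =O[atTop] fun n => agmY n ^ 2 :=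
    ((Real.hasDerivAt_rpow_const (p := s) (Or.inl hP)).isBigO_sub.comp_tendsto
      tendsto_agmP).trans agmP_sub_isBigO
  have h2 : (fun n => agmY n ^ 2) =o[atTop] fun n => 2 ^ n * agmY n ^ 2 := by
    have h3 : (fun _ : ℕ => (1 : ℝ)) =o[atTop] fun n => (2 : ℝ) ^ n := by
      rw [isLittleO_one_left_iff]
      exact tendsto_norm_atTop_atTop.comp (tendsto_pow_atTop_atTop_of_one_lt one_lt_two)
    simpa using h3.mul_isBigO (isBigO_refl (fun n => agmY n ^ 2) atTop)
  exact (h1.trans_isLittleO h2).tendsto_div_nhds_zero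

/-- The limit of `a w`, expressed through the arithmetic-geometric mean. -/
def limitA (w : ℝ) : ℝ := (√2 / agmLimit) ^ (w + 1) * (agmLimit ^ 2 / Real.pi) / 2

lemma tendsto_a_sub (w : ℝ) :
    Tendsto (fun n => (a w n - limitA w) / (2 ^ n * agmY n ^ 2)) atTop
      (𝓝 (-(4 * agmLimit ^ 2 * (√2 / agmLimit) ^ (w + 1)))) := by
  have hP := tendsto_agmP.rpow_const (p := w + 1)
    (Or.inl (div_pos (by positivity) agmLimit_pos).ne')
  have h := ((hP.mul tendsto_agmZ_sub).div_const 2).add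
    ((tendsto_agmP_rpow_sub (w + 1)).mul_const (agmLimit ^ 2 / Real.pi / 2))
  rw [zero_mul, add_zero] at h
  convert! h using 2
  · rw [a_eq, limitA]
    ring
  · ring

lemma limitA_eq (w : ℝ) :
    limitA w = 1 / (Real.Gamma (3 / 4) ^ (2 * w - 2) * Real.pi ^ (3 / 2 - w / 2)) := by
  have h3 : 0 < Real.Gamma (3 / 4) := Real.Gamma_pos_of_pos (by norm_num)
  have hp := Real.pi_pos
  have hs : √Real.pi ^ 2 = Real.pi := Real.sq_sqrt hp.le
  have e1 : √2 / agmLimit = Real.pi ^ (1 / 2 : ℝ) * Real.Gamma (3 / 4) ^ (-2 : ℝ) := by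
    rw [agmLimit_eq, ← Real.sqrt_eq_rpow, Real.rpow_neg h3.le, Real.rpow_two]
    have : 0 < √2 := by positivity
    field_simp
  have e2 : agmLimit ^ 2 / Real.pi / 2 = Real.Gamma (3 / 4) ^ (4 : ℝ) * Real.pi ^ (-2 : ℝ) := by
    rw [agmLimit_eq, div_pow, hs, mul_pow, Real.sq_sqrt zero_le_two, Real.rpow_neg hp.le,
      Real.rpow_two, show (4 : ℝ) = (4 : ℕ) by norm_num, Real.rpow_natCast]
    field_simp
  rw [limitA, mul_div_assoc, e2, e1, Real.mul_rpow (by positivity) (by positivity),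
    ← Real.rpow_mul hp.le, ← Real.rpow_mul h3.le, one_div (_ * _), mul_inv, ← Real.rpow_neg h3.le,
    ← Real.rpow_neg hp.le]
  calc _ = (Real.Gamma (3 / 4) ^ (-2 * (w + 1)) * Real.Gamma (3 / 4) ^ (4 : ℝ)) *
      (Real.pi ^ (1 / 2 * (w + 1)) * Real.pi ^ (-2 : ℝ)) := by ring
    _ = _ := by
      rw [← Real.rpow_add h3, ← Real.rpow_add hp]
      congr 2 <;> ring

theorem convergesQuadratically_of_tendsto_agmY {u : ℕ → ℝ} {L κ : ℝ} (hκ : κ ≠ 0)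
    (h : Tendsto (fun n => (u n - L) / (2 ^ n * agmY n ^ 2)) atTop (𝓝 κ)) :
    ConvergesQuadratically u L :=
  convergesQuadratically_of_tendsto agmY_pos agmY_le agmY_succ_le
    (div_pos agmLimit_pos (by positivity)) le_agmY_succ hκ h

theorem convergesQuadratically_a (w : ℝ) : ConvergesQuadratically (a w)
    (1 / (Real.Gamma (3 / 4) ^ (2 * w - 2) * Real.pi ^ (3 / 2 - w / 2))) := by
  rw [← limitA_eq]
  refine convergesQuadratically_of_tendsto_agmY ?_ (tendsto_a_sub w)
  have := agmLimit_pos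
  exact neg_ne_zero.2 (by positivity)

lemma limitA_one : limitA 1 = 1 / Real.pi := by
  rw [limitA_eq]
  norm_num

lemma limitA_three : limitA 3 = 1 / Real.Gamma (3 / 4) ^ 4 := by
  rw [limitA_eq, show (2 * 3 - 2 : ℝ) = (4 : ℕ) by norm_num,
    show (3 / 2 - 3 / 2 : ℝ) = 0 by norm_num, Real.rpow_natCast, Real.rpow_zero, mul_one]

lemma limitA_one_third : limitA (1 / 3) = (√2 / Real.Gamma (1 / 4)) ^ (4 / 3 : ℝ) := by
  have h3 : 0 < Real.Gamma (3 / 4) := Real.Gamma_pos_of_pos (by norm_num)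
  have h1 : 0 < Real.Gamma (1 / 4) := Real.Gamma_pos_of_pos (by norm_num)
  have hp := Real.pi_pos
  have e : √2 / Real.Gamma (1 / 4) = Real.Gamma (3 / 4) / Real.pi := by
    rw [div_eq_div_iff h1.ne' hp.ne']
    linear_combination -Gamma_one_fourth_mul_Gamma_three_fourths
  rw [limitA_eq, e, Real.div_rpow h3.le hp.le, one_div, mul_inv, ← Real.rpow_neg h3.le,
    ← div_eq_mul_inv]
  norm_num

lemma a_one_eq (n : ℕ) : a 1 n = borweinR n - 2 ^ n * d n ^ 2 := by
  induction n with
  | zero =>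
    rw [a, borweinR, d, div_pow, Real.sq_sqrt zero_le_two]
    norm_num
  | succ n ih =>
    -- This is `agmC_sq_eq` divided by `A (n + 1) ^ 2`.
    have hd : (1 + d (n + 1)) ^ 2 * d n ^ 2 = 4 * d (n + 1) := by
      rw [d]
      have hs := sqrt_one_sub_d_sq_pos n
      have h := sq_sqrt_one_sub_d_sq n
      have e : d n ^ 2 = 1 - √(1 - d n ^ 2) ^ 2 := by linarith
      generalize √(1 - d n ^ 2) = s at *
      rw [e]
      field_simp
      ring
    have hc : c 1 (n + 1) = 2 ^ (n + 2) := by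
      rw [c_eq, sub_self, Real.rpow_zero, mul_one]
    rw [a, hc, ih, borweinR, show (1 : ℝ) + 1 = (2 : ℕ) by norm_num, Real.rpow_natCast]
    linear_combination -(2 : ℝ) ^ n * hd

theorem convergesQuadratically_borweinR : ConvergesQuadratically borweinR (1 / Real.pi) := by
  -- The error of `a 1` contributes `-4 M² (√2 / M)² = -8`, and `2 ^ n d n ^ 2` contributes `16`.
  refine convergesQuadratically_of_tendsto_agmY (κ := 8) (by norm_num) ?_
  have hM := agmLimit_pos
  have h1 : Tendsto (fun n => 16 * agmLimit ^ 2 / agmA n ^ 2) atTop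
      (𝓝 (16 * agmLimit ^ 2 / agmLimit ^ 2)) :=
    tendsto_const_nhds.div (tendsto_agmA.pow 2) (by positivity)
  have h := (tendsto_a_sub 1).add h1
  convert! h using 2 with n
  · have hA := agmA_pos n
    have hY := agmY_pos n
    have hd : d n = 4 * agmLimit * agmY n / agmA n := by
      rw [agmY, agmC]
      field_simp
    have hr : borweinR n = a 1 n + 2 ^ n * d n ^ 2 := by rw [a_one_eq]; ring
    rw [hr, limitA_one, hd]
    field_simp
    ring
  · rw [show (1 : ℝ) + 1 = (2 : ℕ) by norm_num, Real.rpow_natCast, div_pow,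
      Real.sq_sqrt zero_le_two]
    field_simp
    norm_num

/-! ### Algebraicity for rational `w` -/

section Algebraic

lemma isAlgebraic_two : IsAlgebraic ℚ (2 : ℝ) := isAlgebraic_natCast 2

lemma isAlgebraic_sqrt {x : ℝ} (hx : IsAlgebraic ℚ x) (h0 : 0 ≤ x) : IsAlgebraic ℚ √x := by
  refine IsAlgebraic.of_pow (n := 2) two_pos ?_
  rwa [Real.sq_sqrt h0]

lemma isAlgebraic_rpow_ratCast {x : ℝ} (hx : IsAlgebraic ℚ x) (h0 : 0 ≤ x) (q : ℚ) :
    IsAlgebraic ℚ (x ^ (q : ℝ)) := by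
  -- Raising to the denominator turns the rational power into an integer one.
  refine IsAlgebraic.of_pow (n := q.den) q.den_pos ?_
  have h : (q : ℝ) * (q.den : ℕ) = (q.num : ℤ) := by exact_mod_cast Rat.mul_den_eq_num q
  rw [← Real.rpow_natCast, ← Real.rpow_mul h0, h, Real.rpow_intCast]
  cases q.num with
  | ofNat m => simpa using hx.pow m
  | negSucc m => simpa using (hx.pow (m + 1)).inv

lemma isAlgebraic_d (n : ℕ) : IsAlgebraic ℚ (d n) := by
  have h1 : IsAlgebraic ℚ (1 : ℝ) := isAlgebraic_one
  induction n with
  | zero =>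
    rw [d, one_div]
    exact (isAlgebraic_sqrt isAlgebraic_two zero_le_two).inv
  | succ n ih =>
    have hs := isAlgebraic_sqrt (h1.sub (ih.pow 2)) (by nlinarith [d_pos n, d_lt_one n])
    rw [d, div_eq_mul_inv]
    exact (h1.sub hs).mul (h1.add hs).inv

lemma isAlgebraic_c (w : ℚ) (n : ℕ) : IsAlgebraic ℚ (c w n) := by
  induction n with
  | zero => exact isAlgebraic_two
  | succ n ih =>
    have h := isAlgebraic_rpow_ratCast (isAlgebraic_one.add (isAlgebraic_d (n + 1)))
      (one_add_d_pos _).le (w - 1)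
    push_cast at h
    exact (isAlgebraic_two.mul ih).mul h

lemma isAlgebraic_a (w : ℚ) (n : ℕ) : IsAlgebraic ℚ (a w n) := by
  induction n with
  | zero => exact isAlgebraic_zero
  | succ n ih =>
    have hd := isAlgebraic_d (n + 1)
    have h1 : IsAlgebraic ℚ (1 : ℝ) := isAlgebraic_one
    have h2 : IsAlgebraic ℚ (1 / 2 : ℝ) := by
      rw [one_div]
      exact isAlgebraic_two.inv
    have h := isAlgebraic_rpow_ratCast (h1.add hd) (one_add_d_pos _).le (w + 1)
    push_cast at h
    exact (ih.mul h).add (((h2.mul (isAlgebraic_c w (n + 1))).mul hd).mul (h1.sub hd))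

end Algebraic

end QuadAlg

end

theorem mainTheorem1 :
    (∀ w : ℝ, QuadAlg.ConvergesQuadratically (QuadAlg.a w)
      (1 / (Real.Gamma (3 / 4) ^ (2 * w - 2) * Real.pi ^ (3 / 2 - w / 2)))) ∧
    -- the special cases
    QuadAlg.ConvergesQuadratically (QuadAlg.a 1) (1 / Real.pi) ∧
    QuadAlg.ConvergesQuadratically (QuadAlg.a 3) (1 / Real.Gamma (3 / 4) ^ 4) ∧
    QuadAlg.ConvergesQuadratically (QuadAlg.a (1 / 3))
      ((Real.sqrt 2 / Real.Gamma (1 / 4)) ^ (4 / 3 : ℝ)) ∧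
    -- in these cases the algorithm is algebraic
    (∀ w ∈ ({1, 3, 1 / 3} : Set ℝ), ∀ n : ℕ, IsAlgebraic ℚ (QuadAlg.d n) ∧
      IsAlgebraic ℚ (QuadAlg.c w n) ∧ IsAlgebraic ℚ (QuadAlg.a w n)) ∧
    -- the case `w = 1` is the Borweins' quadratic algorithm
    (∀ n : ℕ, QuadAlg.a 1 n = QuadAlg.borweinR n - 2 ^ n * QuadAlg.d n ^ 2) ∧
    QuadAlg.ConvergesQuadratically QuadAlg.borweinR (1 / Real.pi) := by
  have hconv : ∀ w : ℝ, QuadAlg.ConvergesQuadratically (QuadAlg.a w) (QuadAlg.limitA w) :=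
    fun w => QuadAlg.limitA_eq w ▸ QuadAlg.convergesQuadratically_a w
  refine ⟨QuadAlg.convergesQuadratically_a, QuadAlg.limitA_one ▸ hconv 1,
    QuadAlg.limitA_three ▸ hconv 3, QuadAlg.limitA_one_third ▸ hconv (1 / 3), ?_,
    QuadAlg.a_one_eq, QuadAlg.convergesQuadratically_borweinR⟩
  intro w hw n
  obtain ⟨q, rfl⟩ : ∃ q : ℚ, w = q := by
    rcases hw with rfl | rfl | rfl
    · exact ⟨1, by norm_num⟩
    · exact ⟨3, by norm_num⟩
    · exact ⟨1 / 3, by norm_num⟩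
  exact ⟨QuadAlg.isAlgebraic_d n, QuadAlg.isAlgebraic_c q n, QuadAlg.isAlgebraic_a q n⟩
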